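/- Let $n\ge 2$ and $\tfrac12<\beta\le 1$. Let $X$ be a translation-invariant Banach space of tempered distributions on $\mathbb{R}^n$, that is, a complex Banach space of (complex-valued) tempered distributions such that the inclusion $X\hookrightarrow\mathscr{S}'(\mathbb{R}^n)$ is continuous and, for all $f\in X$ and $x_0\in\mathbb{R}^n$, $f(\cdot-x_0)\in X$ with $\|f(\cdot-x_0)\|_X=\|f\|_X$. Suppose that $X$ is critical for the generalized Navier–Stokes equations with dissipation $(-\Delta)^\beta$, that is, for all $f\in X$ and $\lambda>0$, $\lambda^{2\beta-1}f(\lambda\,\cdot)\in X$ with $\|\lambda^{2\beta-1}f(\lambda\,\cdot)\|_X=\|f\|_X$. Then $X$ is continuously embedded in the homogeneous Besov space $\dot B^{1-2\beta}_{\infty,\infty}(\mathbb{R}^n)$: the map sending $f\in X$ to its class in $\mathscr{S}_0'=\mathscr{S}'/\mathcal{P}$ is injective on $X$, takes values in $\dot B^{1-2\beta}_{\infty,\infty}$, and there is a constant $C>0$ with $\|f\|_{\dot B^{1-2\beta}_{\infty,\infty}}\le C\|f\|_X$ for all $f\in X$. Here $\mathscr{S}_0$ is the space of Schwartz functions all of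 whose moments $\int\phi(x)x^\gamma\,dx$ vanish, $\mathcal{P}$ is the space of polynomials, and $\dot B^{s}_{\infty,\infty}$ is the set of $u\in\mathscr{S}_0'$ with $\|u\|_{\dot B^{s}_{\infty,\infty}}=\sup_{j\in\mathbb{Z}}2^{js}\|\Psi_j*u\|_{L^\infty}<\infty$, where $\Psi_j(x)=2^{jn}\Psi_0(2^jx)$, $\widehat{\Psi_0}(\xi)=\phi_0(\xi)/\sum_{k\in\mathbb{Z}}\phi_0(2^{-k}\xi)$ for $\xi\neq0$, $\widehat{\Psi_0}(0)=0$, and $\phi_0\ge0$ is any Schwartz function that is positive exactly on $\{1/2<|\xi|<2\}$ (the constant $C$ may depend on the choice of $\phi_0$). -/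

import Mathlib

open MeasureTheory FourierTransform SchwartzMap
open scoped ENNReal

namespace CriticalBesov

/-- Euclidean space `ℝⁿ`. -/
abbrev E (n : ℕ) : Type := EuclideanSpace ℝ (Fin n)

/-- The map `φ ↦ φ(c ·)` on Schwartz functions, for `c ≠ 0`. -/
noncomputable def schwartzDilate {n : ℕ} (c : ℝ) (hc : c ≠ 0) : 𝓢(E n, ℂ) →L[ℂ] 𝓢(E n, ℂ) :=
  SchwartzMap.compCLMOfContinuousLinearEquiv ℂ
    (ContinuousLinearEquiv.smulLeft (R₁ := ℝ) (M₁ := E n) (Units.mk0 c hc))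

theorem schwartzDilate_apply {n : ℕ} (c : ℝ) (hc : c ≠ 0) (φ : 𝓢(E n, ℂ)) (x : E n) :
    schwartzDilate c hc φ x = φ (c • x) := rfl

/-- The translate `f(· - x₀)` of a tempered distribution: `⟨f(· - x₀), φ⟩ = ⟨f, φ(· + x₀)⟩`. -/
noncomputable def translate {n : ℕ} (x₀ : E n) : 𝓢'(E n, ℂ) →L[ℂ] 𝓢'(E n, ℂ) :=
  PointwiseConvergenceCLM.precomp ℂ (SchwartzMap.compSubConstCLM ℂ (-x₀))

/-- The dilate `f(r ·)` of a tempered distribution, for `r > 0`: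
`⟨f(r ·), φ⟩ = r⁻ⁿ ⟨f, φ(r⁻¹ ·)⟩`. -/
noncomputable def dilate {n : ℕ} (r : ℝ) (hr : 0 < r) : 𝓢'(E n, ℂ) →L[ℂ] 𝓢'(E n, ℂ) :=
  (((r ^ n)⁻¹ : ℝ) : ℂ) •
    PointwiseConvergenceCLM.precomp ℂ (schwartzDilate r⁻¹ (inv_ne_zero hr.ne'))

section Invariance

variable {n : ℕ} {X : Type*} [NormedAddCommGroup X] [NormedSpace ℂ X]

/-- A normed space `X` of tempered distributions (sitting in `𝓢'` through `ι`) is translation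
invariant: `f(· - x₀) ∈ X` with `‖f(· - x₀)‖ = ‖f‖` for all `f ∈ X` and `x₀ ∈ ℝⁿ`. -/
def TranslationInvariant (ι : X →L[ℂ] 𝓢'(E n, ℂ)) : Prop :=
  ∀ (x₀ : E n) (f : X), ∃ g : X, ι g = translate x₀ (ι f) ∧ ‖g‖ = ‖f‖

/-- `X` is critical for the Navier-Stokes equations with dissipation `(-Δ)^β`: it is invariant
under the scaling `f ↦ r^(2β-1) f(r ·)`, that is, `r^(2β-1) f(r ·) ∈ X` with the same norm as `f`,
for all `f ∈ X` and `r > 0`. -/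
def IsCritical (β : ℝ) (ι : X →L[ℂ] 𝓢'(E n, ℂ)) : Prop :=
  ∀ (r : ℝ) (hr : 0 < r) (f : X),
    ∃ g : X, ι g = ((r ^ (2 * β - 1) : ℝ) : ℂ) • dilate r hr (ι f) ∧ ‖g‖ = ‖f‖

end Invariance

/-- The space `𝓢₀` of Schwartz functions all of whose moments vanish. -/
def S0 (n : ℕ) : Submodule ℂ 𝓢(E n, ℂ) where
  carrier := {φ | ∀ γ : Fin n → ℕ, ∫ x : E n, φ x * ∏ i, (x i : ℂ) ^ γ i = 0}
  zero_mem' := by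
    intro γ
    simp
  add_mem' := by
    intro φ ψ hφ hψ γ
    have hI : ∀ θ : 𝓢(E n, ℂ), Integrable (fun x : E n => θ x * ∏ i, (x i : ℂ) ^ γ i) := by
      intro θ
      have hg : Function.HasTemperateGrowth (fun x : E n => ∏ i, (x i : ℂ) ^ γ i) := by
        have hi : ∀ i : Fin n, Function.HasTemperateGrowth (fun x : E n => (x i : ℂ)) := fun i =>
          (Complex.ofRealCLM.comp (EuclideanSpace.proj (𝕜 := ℝ) i)).hasTemperateGrowth
        have hs : ∀ s : Finset (Fin n),
            Function.HasTemperateGrowth (fun x : E n => ∏ i ∈ s, (x i : ℂ) ^ γ i) := by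
          classical
          intro s
          induction s using Finset.induction_on with
          | empty => simp
          | insert a s ha ih =>
            simp only [Finset.prod_insert ha]
            exact ((hi a).pow _).mul ih
        exact hs Finset.univ
      refine (SchwartzMap.integrable (μ := volume) (SchwartzMap.smulLeftCLM ℂ
        (fun x : E n => ∏ i, (x i : ℂ) ^ γ i) θ)).congr (Filter.Eventually.of_forall fun x => ?_)
      simp [SchwartzMap.smulLeftCLM_apply_apply hg, mul_comm]
    have h := integral_add (hI φ) (hI ψ)
    simp only [← add_mul] at h
    simpa [hφ γ, hψ γ] using h
  smul_mem' := by
    intro c φ hφ γ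
    have h := integral_const_mul (μ := (volume : Measure (E n))) c
      (fun x : E n => φ x * ∏ i, (x i : ℂ) ^ γ i)
    simp only [← mul_assoc] at h
    simpa [hφ γ] using h

/-- The dual space `𝓢₀'` of `𝓢₀`, i.e. tempered distributions modulo polynomials. -/
abbrev S0' (n : ℕ) : Type := S0 n →Lₚₜ[ℂ] ℂ

/-- The canonical map `𝓢' → 𝓢₀'`: the class of a tempered distribution modulo polynomials. -/
noncomputable def toS0' {n : ℕ} : 𝓢'(E n, ℂ) →L[ℂ] S0' n :=
  PointwiseConvergenceCLM.precomp ℂ (S0 n).subtypeL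

/-- A homogeneous Littlewood-Paley decomposition of `ℝⁿ`, built from a Schwartz function `φ₀ ≥ 0`
that is positive exactly on the annulus `1/2 < |ξ| < 2`; the Schwartz function `Ψ = Ψ₀` has Fourier
transform `φ₀ / ∑ⱼ φ₀(2⁻ʲ ·)`. The Fourier transform is meant with the kernel `e^{-i x·ξ}`, whose
value at `ξ` is the value of Mathlib's `𝓕` at `ξ / (2π)`. At `ξ = 0` the quotient is `0`. -/
structure LittlewoodPaley (n : ℕ) where
  φ₀ : 𝓢(E n, ℝ)
  nonneg : ∀ ξ, 0 ≤ φ₀ ξ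
  pos_iff : ∀ ξ, 0 < φ₀ ξ ↔ 1 / 2 < ‖ξ‖ ∧ ‖ξ‖ < 2
  Ψ : 𝓢(E n, ℂ)
  fourier_Ψ : ∀ ξ : E n, 𝓕 Ψ ((2 * Real.pi)⁻¹ • ξ) =
    ((φ₀ ξ / ∑' j : ℤ, φ₀ ((2 : ℝ) ^ (-j) • ξ) : ℝ) : ℂ)

/-- The function `y ↦ Ψⱼ(x - y)`, where `Ψⱼ(x) = 2^{jn} Ψ(2ʲ x)`. -/
noncomputable def kernel {n : ℕ} (Ψ : 𝓢(E n, ℂ)) (j : ℤ) (x : E n) : 𝓢(E n, ℂ) :=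
  ((((2 : ℝ) ^ j) ^ n : ℝ) : ℂ) • SchwartzMap.compSubConstCLM ℂ x
    (schwartzDilate (-(2 : ℝ) ^ j) (neg_ne_zero.mpr (zpow_ne_zero j two_ne_zero)) Ψ)

theorem kernel_apply {n : ℕ} (Ψ : 𝓢(E n, ℂ)) (j : ℤ) (x y : E n) :
    kernel Ψ j x y = ((((2 : ℝ) ^ j) ^ n : ℝ) : ℂ) * Ψ ((2 : ℝ) ^ j • (x - y)) := by
  have h : -(2 : ℝ) ^ j • (y - x) = (2 : ℝ) ^ j • (x - y) := by
    rw [neg_smul, ← smul_neg, neg_sub]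
  simp [kernel, schwartzDilate_apply, h]

section Membership

variable {n : ℕ}

/-- The Fourier transform vanishes near the origin. -/
def FourierVanishes (φ : 𝓢(E n, ℂ)) : Prop :=
  ∃ ε > 0, ∀ ξ : E n, ‖ξ‖ < ε → 𝓕 φ ξ = 0

theorem FourierVanishes.smul {φ : 𝓢(E n, ℂ)} (h : FourierVanishes φ) (c : ℂ) :
    FourierVanishes (c • φ) := by
  obtain ⟨ε, hε, h⟩ := h
  refine ⟨ε, hε, fun ξ hξ => ?_⟩
  simp [FourierTransform.fourier_smul, h ξ hξ]

theorem FourierVanishes.translate {φ : 𝓢(E n, ℂ)} (h : FourierVanishes φ) (a : E n) :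
    FourierVanishes (SchwartzMap.compSubConstCLM ℂ a φ) := by
  obtain ⟨ε, hε, h⟩ := h
  refine ⟨ε, hε, fun ξ hξ => ?_⟩
  have h1 := h ξ hξ
  rw [SchwartzMap.fourier_coe, Real.fourier_eq] at h1 ⊢
  rw [← integral_add_right_eq_self _ a]
  simp only [SchwartzMap.compSubConstCLM_apply, add_sub_cancel_right, inner_add_left, neg_add]
  simp only [AddChar.map_add_eq_mul, mul_comm _ (Real.fourierChar (-inner ℝ a ξ)), mul_smul]
  simp only [Circle.smul_def] at h1 ⊢
  rw [integral_smul, h1, smul_zero]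

theorem FourierVanishes.dilate {φ : 𝓢(E n, ℂ)} (h : FourierVanishes φ) (c : ℝ) (hc : c ≠ 0) :
    FourierVanishes (schwartzDilate c hc φ) := by
  obtain ⟨ε, hε, h⟩ := h
  refine ⟨|c| * ε, by positivity, fun ξ hξ => ?_⟩
  have h1 := h (c⁻¹ • ξ) (by
    rw [norm_smul, norm_inv, Real.norm_eq_abs, inv_mul_lt_iff₀ (by positivity)]
    exact hξ)
  rw [SchwartzMap.fourier_coe, Real.fourier_eq] at h1 ⊢
  have h2 := Measure.integral_comp_smul (volume : Measure (E n))
    (fun v : E n => Real.fourierChar (-inner ℝ v (c⁻¹ • ξ)) • φ v) c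
  rw [h1, smul_zero] at h2
  rw [← h2]
  refine integral_congr_ae (Filter.Eventually.of_forall fun v => ?_)
  simp only [schwartzDilate_apply, real_inner_smul_left, real_inner_smul_right]
  rw [inv_mul_cancel_left₀ hc]

theorem FourierVanishes.mul_coord {φ : 𝓢(E n, ℂ)} (h : FourierVanishes φ) (i : Fin n) :
    ∃ ψ : 𝓢(E n, ℂ), FourierVanishes ψ ∧ ∀ x, ψ x = φ x * (x i : ℂ) := by
  obtain ⟨ε, hε, h⟩ := h
  set m : E n := EuclideanSpace.single i 1
  have hm : Function.HasTemperateGrowth (fun x : E n => inner ℝ x m) := by fun_prop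
  refine ⟨SchwartzMap.smulLeftCLM ℂ (fun x : E n => inner ℝ x m) φ, ⟨ε, hε, fun ξ hξ => ?_⟩,
    fun x => ?_⟩
  · have h1 := congrArg (fun f : 𝓢(E n, ℂ) => f ξ) (SchwartzMap.lineDerivOp_fourier_eq φ m)
    have h2 : (LineDeriv.lineDerivOp m (𝓕 φ) : 𝓢(E n, ℂ)) ξ = 0 := by
      rw [SchwartzMap.lineDerivOp_apply_eq_fderiv]
      have h3 : (𝓕 φ : 𝓢(E n, ℂ)) =ᶠ[nhds ξ] fun _ => (0 : ℂ) := by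
        have : {η : E n | ‖η‖ < ε} ∈ nhds ξ :=
          (isOpen_lt continuous_norm continuous_const).mem_nhds hξ
        filter_upwards [this] with η hη using h η hη
      rw [h3.fderiv_eq]
      simp
    simp only [h2, FourierTransform.fourier_smul, _root_.smul_apply, smul_eq_mul] at h1
    have h4 : (-(2 * Real.pi * Complex.I) : ℂ) ≠ 0 := by
      simp [Real.pi_ne_zero]
    exact (mul_eq_zero.mp h1.symm).resolve_left h4
  · rw [SchwartzMap.smulLeftCLM_apply_apply hm]
    simp [m, EuclideanSpace.inner_single_right, mul_comm]

theorem FourierVanishes.integral_eq_zero {φ : 𝓢(E n, ℂ)} (h : FourierVanishes φ) :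
    ∫ x, φ x = 0 := by
  obtain ⟨ε, hε, h⟩ := h
  have h1 := h 0 (by simpa using hε)
  rw [SchwartzMap.fourier_coe, Real.fourier_eq] at h1
  simpa using h1

theorem FourierVanishes.mul_coord_pow {φ : 𝓢(E n, ℂ)} (h : FourierVanishes φ) (i : Fin n) (k : ℕ) :
    ∃ ψ : 𝓢(E n, ℂ), FourierVanishes ψ ∧ ∀ x, ψ x = φ x * (x i : ℂ) ^ k := by
  induction k with
  | zero => exact ⟨φ, h, by simp⟩
  | succ k ih =>
    obtain ⟨ψ, hψ, hψ'⟩ := ih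
    obtain ⟨θ, hθ, hθ'⟩ := hψ.mul_coord i
    exact ⟨θ, hθ, fun x => by rw [hθ', hψ', pow_succ, mul_assoc]⟩

theorem FourierVanishes.mul_prod {φ : 𝓢(E n, ℂ)} (h : FourierVanishes φ) (γ : Fin n → ℕ)
    (s : Finset (Fin n)) :
    ∃ ψ : 𝓢(E n, ℂ), FourierVanishes ψ ∧ ∀ x, ψ x = φ x * ∏ i ∈ s, (x i : ℂ) ^ γ i := by
  classical
  induction s using Finset.induction_on with
  | empty => exact ⟨φ, h, by simp⟩
  | insert a s ha ih =>
    obtain ⟨ψ, hψ, hψ'⟩ := ih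
    obtain ⟨θ, hθ, hθ'⟩ := hψ.mul_coord_pow a (γ a)
    refine ⟨θ, hθ, fun x => ?_⟩
    rw [hθ', hψ', Finset.prod_insert ha]
    ring

theorem FourierVanishes.mem_S0 {φ : 𝓢(E n, ℂ)} (h : FourierVanishes φ) : φ ∈ S0 n := by
  intro γ
  obtain ⟨ψ, hψ, hψ'⟩ := h.mul_prod γ Finset.univ
  simp only [← hψ']
  exact hψ.integral_eq_zero

theorem LittlewoodPaley.fourierVanishes (L : LittlewoodPaley n) : FourierVanishes L.Ψ := by
  have hpi := Real.pi_pos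
  refine ⟨(2 * Real.pi)⁻¹ * (1 / 2), by positivity, fun ξ hξ => ?_⟩
  have h1 := L.fourier_Ψ ((2 * Real.pi) • ξ)
  rw [inv_smul_smul₀ (by positivity)] at h1
  have h2 : L.φ₀ ((2 * Real.pi) • ξ) = 0 := by
    refine le_antisymm (not_lt.mp fun hlt => ?_) (L.nonneg _)
    have h3 := ((L.pos_iff _).mp hlt).1
    rw [norm_smul, Real.norm_of_nonneg (by positivity)] at h3
    rw [lt_inv_mul_iff₀ (by positivity)] at hξ
    linarith
  rw [h1, h2]
  simp

theorem LittlewoodPaley.kernel_mem (L : LittlewoodPaley n) (j : ℤ) (x : E n) :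
    kernel L.Ψ j x ∈ S0 n :=
  (((L.fourierVanishes.dilate _ _).translate x).smul _).mem_S0

end Membership

/-- The dyadic block `Δⱼ u = Ψⱼ * u` of `u ∈ 𝓢₀'`: the function `x ↦ ⟨u, Ψⱼ(x - ·)⟩`. -/
noncomputable def dyadicBlock {n : ℕ} (L : LittlewoodPaley n) (j : ℤ) (u : S0' n) : E n → ℂ :=
  fun x => u ⟨kernel L.Ψ j x, L.kernel_mem j x⟩

/-- The norm of the homogeneous Besov space `Ḃ^s_{∞,∞}`, namely `supⱼ 2^{js} ‖Δⱼ u‖_{L^∞}`, with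
values in `[0, ∞]`. -/
noncomputable def besovNorm {n : ℕ} (L : LittlewoodPaley n) (s : ℝ) (u : S0' n) : ℝ≥0∞ :=
  ⨆ j : ℤ, ENNReal.ofReal ((2 : ℝ) ^ ((j : ℝ) * s)) * eLpNorm (dyadicBlock L j u) ∞ volume

/-- The homogeneous Besov space `Ḃ^s_{∞,∞}`, a set of elements of `𝓢₀'`. -/
def besovSpace {n : ℕ} (L : LittlewoodPaley n) (s : ℝ) : Set (S0' n) :=
  {u | besovNorm L s u < ∞}

end CriticalBesov

open CriticalBesov

open CriticalBesov

/-! Besov bound: `Δⱼf(x)` is `f` tested against a translate of a dilate of the single function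
`Ψ(-·)`. Continuity of `X → 𝓢'` bounds the pairing with `Ψ(-·)` by `K‖f‖`; translation invariance
moves it to any `x` for free, and criticality moves it to scale `2⁻ʲ` at the price `2^{j(2β-1)}`,
which the Besov weight cancels.

Injectivity (`IsCritical.apply_eq_zero`): let `f` vanish on `𝓢₀`, and let `m` be a Schwartz function
equal to `1` on the unit ball. For `r ≥ 1`, subtracting from `φ` its low-frequency part `ρ`, with
transform `m(rξ) 𝓕φ(ξ)`, leaves an element of `𝓢₀`, so `⟨f, φ⟩ = ⟨f, ρ⟩`. Rescaled by `r`, `ρ`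
becomes `ψ` with transform `m · 𝓕φ(·/r)`; these `ψ` stay in a bounded subset of `𝓢`.
Banach–Steinhaus and criticality give `|⟨f, φ⟩| ≤ r^{1-2β} K‖f‖`, which tends to `0` as `r → ∞`
because `β > 1/2`. -/

namespace CriticalBesov

variable {n : ℕ}

/-! ### Dilations of Schwartz functions -/

/-- The iterated derivatives of a dilate `φ(c ·)` with `|c| ≤ 1` are bounded by a seminorm of
`φ`. -/
theorem norm_iteratedFDeriv_schwartzDilate_le (φ : 𝓢(E n, ℂ)) {c : ℝ} (hc : c ≠ 0) (hc' : |c| ≤ 1)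
    (i : ℕ) (x : E n) :
    ‖iteratedFDeriv ℝ i (schwartzDilate c hc φ) x‖ ≤ SchwartzMap.seminorm ℝ 0 i φ := by
  have h : (schwartzDilate c hc φ : E n → ℂ) = φ ∘ (c • ContinuousLinearMap.id ℝ (E n)) := by
    ext y
    simp [schwartzDilate_apply]
  rw [h, ContinuousLinearMap.iteratedFDeriv_comp_right _ (φ.smooth i) x le_rfl]
  refine (ContinuousMultilinearMap.norm_compContinuousLinearMap_le _ _).trans ?_
  have h1 : ‖c • ContinuousLinearMap.id ℝ (E n)‖ ≤ 1 := by
    rw [norm_smul, Real.norm_eq_abs]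
    exact mul_le_one₀ hc' (norm_nonneg _) ContinuousLinearMap.norm_id_le
  refine (mul_le_of_le_one_right (norm_nonneg _)
    (Finset.prod_le_one (fun _ _ => norm_nonneg _) fun _ _ => h1)).trans ?_
  simpa using SchwartzMap.le_seminorm ℝ 0 i φ ((c • ContinuousLinearMap.id ℝ (E n)) x)

/-- The product of Schwartz functions. -/
noncomputable def schwartzMul (φ θ : 𝓢(E n, ℂ)) : 𝓢(E n, ℂ) :=
  SchwartzMap.pairing (ContinuousLinearMap.mul ℂ ℂ) φ θ

theorem schwartzMul_apply (φ θ : 𝓢(E n, ℂ)) (x : E n) : schwartzMul φ θ x = φ x * θ x := rfl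

/-- The products of a Schwartz function with the dilates `θ(c ·)`, `|c| ≤ 1`, of another one form a
bounded subset of the Schwartz space. -/
theorem isVonNBounded_schwartzMul_schwartzDilate (m θ : 𝓢(E n, ℂ)) :
    Bornology.IsVonNBounded ℂ
      {φ | ∃ (c : ℝ) (hc : c ≠ 0), |c| ≤ 1 ∧ φ = schwartzMul m (schwartzDilate c hc θ)} := by
  rw [(schwartz_withSeminorms ℂ (E n) ℂ).isVonNBounded_iff_seminorm_bddAbove]
  rintro ⟨k, l⟩
  -- Leibniz, with the whole weight `‖x‖ ^ k` placed on `m`: weighted seminorms of `θ(c ·)` need not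
  -- stay bounded as `c → 0`.
  refine ⟨∑ i ∈ Finset.range (l + 1), (l.choose i : ℝ) * SchwartzMap.seminorm ℝ k i m *
    SchwartzMap.seminorm ℝ 0 (l - i) θ, ?_⟩
  rintro _ ⟨_, ⟨c, hc, hc', rfl⟩, rfl⟩
  refine SchwartzMap.seminorm_le_bound ℂ k l _ (by positivity) fun x => ?_
  have h := norm_iteratedFDeriv_mul_le (m.smooth ⊤) ((schwartzDilate c hc θ).smooth ⊤) x
    (n := l) (mod_cast le_top)
  have h' : (schwartzMul m (schwartzDilate c hc θ) : E n → ℂ) =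
      fun y => m y * schwartzDilate c hc θ y := rfl
  rw [h']
  grw [h, Finset.mul_sum]
  refine Finset.sum_le_sum fun i _ => ?_
  have h1 := SchwartzMap.le_seminorm ℝ k i m x
  have h2 := norm_iteratedFDeriv_schwartzDilate_le θ hc hc' (l - i) x
  calc ‖x‖ ^ k * ((l.choose i : ℝ) * ‖iteratedFDeriv ℝ i m x‖ *
        ‖iteratedFDeriv ℝ (l - i) (schwartzDilate c hc θ) x‖)
      = (l.choose i : ℝ) * (‖x‖ ^ k * ‖iteratedFDeriv ℝ i m x‖) *
        ‖iteratedFDeriv ℝ (l - i) (schwartzDilate c hc θ) x‖ := by ring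
    _ ≤ _ := by gcongr

/-- The Fourier transform of `c⁻ⁿ φ(c⁻¹ ·)` is `𝓕 φ (c ·)`. -/
theorem fourier_schwartzDilate_inv (φ : 𝓢(E n, ℂ)) {c : ℝ} (hc : 0 < c) (ξ : E n) :
    𝓕 ((((c ^ n)⁻¹ : ℝ) : ℂ) • schwartzDilate c⁻¹ (inv_ne_zero hc.ne') φ) ξ = 𝓕 φ (c • ξ) := by
  have h2 := Measure.integral_comp_smul (volume : Measure (E n))
    (fun v : E n => Real.fourierChar (-inner ℝ v (c • ξ)) • φ v) c⁻¹
  rw [FourierTransform.fourier_smul, _root_.smul_apply, SchwartzMap.fourier_coe,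
    SchwartzMap.fourier_coe, Real.fourier_eq, Real.fourier_eq]
  have h3 : ∀ v : E n, Real.fourierChar (-inner ℝ v ξ) •
      schwartzDilate c⁻¹ (inv_ne_zero hc.ne') φ v =
      Real.fourierChar (-inner ℝ (c⁻¹ • v) (c • ξ)) • φ (c⁻¹ • v) := by
    intro v
    rw [schwartzDilate_apply, real_inner_smul_left, real_inner_smul_right,
      inv_mul_cancel_left₀ hc.ne']
  simp only [h3]
  rw [h2]
  have h4 : |((c⁻¹ ^ n)⁻¹ : ℝ)| = c ^ n := by
    rw [inv_pow, inv_inv, abs_of_pos (by positivity)]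
  rw [finrank_euclideanSpace_fin, h4, ← Complex.coe_smul, smul_smul, ← Complex.ofReal_mul,
    inv_mul_cancel₀ (by positivity), Complex.ofReal_one, one_smul]

/-- There is a Schwartz function equal to `1` on the unit ball. -/
theorem exists_schwartz_eq_one (n : ℕ) : ∃ m : 𝓢(E n, ℂ), ∀ ξ : E n, ‖ξ‖ ≤ 1 → m ξ = 1 := by
  let b : ContDiffBump (0 : E n) := ⟨1, 2, one_pos, one_lt_two⟩
  have hs : HasCompactSupport (fun ξ : E n => ((b ξ : ℝ) : ℂ)) :=
    b.hasCompactSupport.comp_left (g := fun t : ℝ => (t : ℂ)) Complex.ofReal_zero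
  have hc : ContDiff ℝ (⊤ : ℕ∞) (fun ξ : E n => ((b ξ : ℝ) : ℂ)) :=
    Complex.ofRealCLM.contDiff.comp b.contDiff
  refine ⟨hs.toSchwartzMap hc, fun ξ hξ => ?_⟩
  have : b ξ = 1 := b.one_of_mem_closedBall (by simpa [b] using hξ)
  change ((b ξ : ℝ) : ℂ) = 1
  rw [this, Complex.ofReal_one]

/-! ### Estimates from completeness, translation invariance and criticality -/

section Invariance

variable {X : Type*} [NormedAddCommGroup X] [NormedSpace ℂ X] {ι : X →L[ℂ] 𝓢'(E n, ℂ)} {β : ℝ}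

/-- A test function, as a continuous linear functional on `X`. -/
noncomputable def testFunctional (ι : X →L[ℂ] 𝓢'(E n, ℂ)) (φ : 𝓢(E n, ℂ)) : X →L[ℂ] ℂ :=
  (PointwiseConvergenceCLM.evalCLM (RingHom.id ℂ) ℂ φ).comp ι

/-- The functionals given by a bounded set of test functions are uniformly bounded. -/
theorem exists_norm_apply_le [CompleteSpace X] (ι : X →L[ℂ] 𝓢'(E n, ℂ)) {S : Set 𝓢(E n, ℂ)}
    (hS : Bornology.IsVonNBounded ℂ S) :
    ∃ K : ℝ, ∀ φ ∈ S, ∀ f : X, ‖ι f φ‖ ≤ K * ‖f‖ := by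
  obtain ⟨K, hK⟩ := banach_steinhaus (g := fun φ : S => testFunctional ι φ) fun f => by
    let T : 𝓢(E n, ℂ) →L[ℂ] ℂ := ι f
    obtain ⟨C, hC⟩ := (NormedSpace.isVonNBounded_iff' ℂ).mp (hS.image T)
    exact ⟨C, fun φ => hC _ ⟨φ, φ.2, rfl⟩⟩
  exact ⟨K, fun φ hφ f => (testFunctional ι φ).le_of_opNorm_le (hK ⟨φ, hφ⟩) f⟩

/-- Translating the test function by `a` amounts to translating `f` by `-a`, which keeps its norm.
-/
theorem TranslationInvariant.norm_apply_le (h : TranslationInvariant ι) {φ : 𝓢(E n, ℂ)} {K : ℝ}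
    (hK : ∀ f : X, ‖ι f φ‖ ≤ K * ‖f‖) (a : E n) (f : X) :
    ‖ι f (SchwartzMap.compSubConstCLM ℂ a φ)‖ ≤ K * ‖f‖ := by
  obtain ⟨g, hg, hgf⟩ := h (-a) f
  have h1 : ι g φ = ι f (SchwartzMap.compSubConstCLM ℂ a φ) := by
    rw [hg]
    simp only [translate, neg_neg]
    rfl
  rw [← h1, ← hgf]
  exact hK g

/-- Apply `hK` to `r^(2β-1) f(r ·)`, which has the norm of `f`, and divide by `r^(2β-1)`. -/
theorem IsCritical.norm_apply_le (h : IsCritical β ι) {φ : 𝓢(E n, ℂ)} {K : ℝ}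
    (hK : ∀ f : X, ‖ι f φ‖ ≤ K * ‖f‖) {r : ℝ} (hr : 0 < r) (f : X) :
    ‖ι f ((((r ^ n)⁻¹ : ℝ) : ℂ) • schwartzDilate r⁻¹ (inv_ne_zero hr.ne') φ)‖ ≤
      r ^ (1 - 2 * β) * (K * ‖f‖) := by
  obtain ⟨g, hg, hgf⟩ := h r hr f
  have h1 : ι g φ = ((r ^ (2 * β - 1) : ℝ) : ℂ) *
      ι f ((((r ^ n)⁻¹ : ℝ) : ℂ) • schwartzDilate r⁻¹ (inv_ne_zero hr.ne') φ) := by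
    rw [hg, map_smul]
    rfl
  have h2 := hK g
  rw [h1, hgf, norm_mul, Complex.norm_real, Real.norm_of_nonneg (by positivity)] at h2
  rw [show 1 - 2 * β = -(2 * β - 1) by ring, Real.rpow_neg hr.le]
  rwa [← div_eq_inv_mul, le_div_iff₀' (by positivity)]

/-- An element of a critical space that vanishes on `𝓢₀` is zero. -/
theorem IsCritical.apply_eq_zero [CompleteSpace X] (h : IsCritical β ι) (hβ : 1 / 2 < β) {f : X}
    (hf : ∀ φ ∈ S0 n, ι f φ = 0) (φ : 𝓢(E n, ℂ)) : ι f φ = 0 := by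
  obtain ⟨m, hm⟩ := exists_schwartz_eq_one n
  -- `K` is fixed before `r`: uniformity in `r` is what makes the limit work.
  obtain ⟨K, hK⟩ := exists_norm_apply_le ι
    ((isVonNBounded_schwartzMul_schwartzDilate m (𝓕 φ)).image
      (FourierTransform.fourierInvCLM ℂ 𝓢(E n, ℂ)))
  have hbound : ∀ r : ℝ, 1 ≤ r → ‖ι f φ‖ ≤ r ^ (-(2 * β - 1)) * (K * ‖f‖) := by
    intro r hr
    have hr0 : 0 < r := by positivity
    set ψ : 𝓢(E n, ℂ) := 𝓕⁻ (schwartzMul m (schwartzDilate r⁻¹ (inv_ne_zero hr0.ne') (𝓕 φ)))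
      with hψ
    have h1 := h.norm_apply_le (φ := ψ) (fun g => hK _ ⟨_, ⟨r⁻¹, inv_ne_zero hr0.ne', by
      rw [abs_of_pos (by positivity)]
      exact inv_le_one_of_one_le₀ hr, rfl⟩, rfl⟩ g) hr0 f
    set ρ := (((r ^ n)⁻¹ : ℝ) : ℂ) • schwartzDilate r⁻¹ (inv_ne_zero hr0.ne') ψ with hρ
    -- The transform is `(1 - m(rξ)) 𝓕φ(ξ)`, zero for `‖ξ‖ < 1/r`.
    have h2 : FourierVanishes (φ - ρ) := by
      refine ⟨r⁻¹, by positivity, fun ξ hξ => ?_⟩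
      have h3 : ‖r • ξ‖ ≤ 1 := by
        rw [norm_smul, Real.norm_of_nonneg hr0.le]
        exact ((lt_inv_mul_iff₀ hr0).mp (by simpa using hξ)).le
      rw [← FourierTransform.fourierCLM_apply (R := ℂ), map_sub, _root_.sub_apply,
        FourierTransform.fourierCLM_apply, FourierTransform.fourierCLM_apply, hρ, fourier_schwartzDilate_inv _ hr0, hψ,
        FourierTransform.fourier_fourierInv_eq, schwartzMul_apply, hm _ h3, schwartzDilate_apply,
        inv_smul_smul₀ hr0.ne', one_mul, sub_self]
    have h4 := hf _ h2.mem_S0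
    rw [map_sub, sub_eq_zero] at h4
    rw [h4, show -(2 * β - 1) = 1 - 2 * β by ring]
    exact h1
  have hlim : Filter.Tendsto (fun r : ℝ => r ^ (-(2 * β - 1)) * (K * ‖f‖)) Filter.atTop
      (nhds (0 * (K * ‖f‖))) :=
    (tendsto_rpow_neg_atTop (by linarith)).mul_const _
  rw [zero_mul] at hlim
  exact norm_le_zero_iff.mp
    (ge_of_tendsto hlim (Filter.eventually_atTop.mpr ⟨1, hbound⟩))

/-- The kernel at `x` is the `x`-translate of the rescaling of `Ψ(-·)` with `r = 2⁻ʲ`; the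
reflection comes from `y ↦ Ψ(x - y)`. -/
theorem norm_dyadicBlock_le (htrans : TranslationInvariant ι) (hcrit : IsCritical β ι)
    (L : LittlewoodPaley n) {K : ℝ}
    (hK : ∀ f : X, ‖ι f (schwartzDilate (-1) (neg_ne_zero.mpr one_ne_zero) L.Ψ)‖ ≤ K * ‖f‖)
    (j : ℤ) (f : X) (x : E n) :
    ‖dyadicBlock L j (toS0' (ι f)) x‖ ≤ (2 : ℝ) ^ ((j : ℝ) * (2 * β - 1)) * (K * ‖f‖) := by
  have hr : 0 < (2 : ℝ) ^ (-j) := by positivity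
  have hker : kernel L.Ψ j x = SchwartzMap.compSubConstCLM ℂ x
      (((((((2 : ℝ) ^ (-j)) ^ n)⁻¹ : ℝ)) : ℂ) • schwartzDilate ((2 : ℝ) ^ (-j))⁻¹
        (inv_ne_zero hr.ne') (schwartzDilate (-1) (neg_ne_zero.mpr one_ne_zero) L.Ψ)) := by
    ext y
    simp [kernel, schwartzDilate_apply]
  have h1 := htrans.norm_apply_le (K := ((2 : ℝ) ^ (-j)) ^ (1 - 2 * β) * K)
    (fun g => (hcrit.norm_apply_le hK hr g).trans_eq (mul_assoc _ _ _).symm) x f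
  have h2 : ((2 : ℝ) ^ (-j)) ^ (1 - 2 * β) = (2 : ℝ) ^ ((j : ℝ) * (2 * β - 1)) := by
    rw [← Real.rpow_intCast, ← Real.rpow_mul zero_le_two]
    congr 1
    push_cast
    ring
  rw [← hker, h2, mul_assoc] at h1
  exact h1

theorem besovNorm_toS0'_le (htrans : TranslationInvariant ι) (hcrit : IsCritical β ι)
    (L : LittlewoodPaley n) {K : ℝ}
    (hK : ∀ f : X, ‖ι f (schwartzDilate (-1) (neg_ne_zero.mpr one_ne_zero) L.Ψ)‖ ≤ K * ‖f‖)
    (f : X) :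
    besovNorm L (1 - 2 * β) (toS0' (ι f)) ≤ ENNReal.ofReal (K * ‖f‖) := by
  refine iSup_le fun j => ?_
  have h1 : eLpNorm (dyadicBlock L j (toS0' (ι f))) ∞ volume ≤
      ENNReal.ofReal ((2 : ℝ) ^ ((j : ℝ) * (2 * β - 1)) * (K * ‖f‖)) := by
    rw [eLpNorm_exponent_top]
    exact eLpNormEssSup_le_of_ae_bound
      (Filter.Eventually.of_forall (norm_dyadicBlock_le htrans hcrit L hK j f))
  grw [h1]
  rw [← ENNReal.ofReal_mul (by positivity), ← mul_assoc, ← Real.rpow_add two_pos]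
  ring_nf
  simp

end Invariance

end CriticalBesov

theorem theorem4p5 {n : ℕ} (hn : 2 ≤ n) {β : ℝ} (hβ : 1 / 2 < β) (hβ' : β ≤ 1)
    {X : Type*} [NormedAddCommGroup X] [NormedSpace ℂ X] [CompleteSpace X]
    (ι : X →L[ℂ] 𝓢'(E n, ℂ)) (hι : Function.Injective ι)
    (htrans : TranslationInvariant ι) (hcrit : IsCritical β ι)
    (L : LittlewoodPaley n) :
    Function.Injective (fun f : X => toS0' (ι f)) ∧
    (∀ f : X, toS0' (ι f) ∈ besovSpace L (1 - 2 * β)) ∧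
    ∃ C : ℝ, 0 < C ∧ ∀ f : X,
      besovNorm L (1 - 2 * β) (toS0' (ι f)) ≤ ENNReal.ofReal (C * ‖f‖) := by
  set T := testFunctional ι (schwartzDilate (-1) (neg_ne_zero.mpr one_ne_zero) L.Ψ)
  -- The `+ 1` only makes the constant strictly positive.
  have hK : ∀ f : X, ‖ι f (schwartzDilate (-1) (neg_ne_zero.mpr one_ne_zero) L.Ψ)‖ ≤
      (‖T‖ + 1) * ‖f‖ := fun f =>
    T.le_of_opNorm_le (le_add_of_nonneg_right zero_le_one) f
  have hB := besovNorm_toS0'_le htrans hcrit L hK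
  refine ⟨fun f g hfg => ?_, fun f => (hB f).trans_lt ENNReal.ofReal_lt_top,
    ‖T‖ + 1, by positivity, hB⟩
  have h0 : toS0' (ι (f - g)) = 0 := by
    rw [map_sub, map_sub, sub_eq_zero]
    exact hfg
  have h1 : ι (f - g) = 0 := by
    ext φ
    exact hcrit.apply_eq_zero hβ (fun ψ hψ => DFunLike.congr_fun h0 (⟨ψ, hψ⟩ : S0 n)) φ
  exact sub_eq_zero.mp (hι (h1.trans (map_zero ι).symm))
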